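/- For an integer $p\ge 1$ and $x,y\in\mathbb{R}$ put $$\mathrm{power}_p(x,y)=\frac{\operatorname{sign}(x)+\operatorname{sign}(y)}{2}\,\frac{x+y}{2}\left(1-\left|\frac{x-y}{x+y}\right|^p\right),$$ with $\operatorname{sign}(0)=0$ and $\mathrm{power}_p(x,y)=0$ when $x+y=0$. For a real sequence $f=(f_n)_{n\in\mathbb{Z}}$ let $Df_n=f_{n+1}-2f_n+f_{n-1}$. The Power-P subdivision scheme $S=S_{\mathrm{power}_p}$ is obtained from the centered four-point Lagrange interpolatory scheme by replacing the arithmetic mean of $Df_n$ and $Df_{n+1}$ by $\mathrm{power}_p(Df_n,Df_{n+1})$: $$S(f)_{2n}=f_n,\qquad S(f)_{2n+1}=\frac{f_n+f_{n+1}}{2}-\frac18\,\mathrm{power}_p(Df_n,Df_{n+1})\qquad(n\in\mathbb{Z}).$$ For $0<\alpha\le 1$ let $C^{\alpha-}$ be the set of bounded continuous functions $g:\mathbb{R}\to\mathbb{R}$ such that for every $\alpha'$ with $0<\alpha'<\alpha$ there is $C>0$ with $|g(x)-g(y)|\le C|x-y|^{\alpha'}$ for all $x,y\in\mathbb{R}$.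 **Proposition.** Let $p\ge 1$ be an integer. The Power-P subdivision scheme is uniformly convergent: for every $f\in\ell^\infty(\mathbb{Z})$ there is a continuous function $f^\infty:\mathbb{R}\to\mathbb{R}$ with $$\lim_{j\to+\infty}\ \sup_{n\in\mathbb{Z}}\left|S^j(f)_n-f^\infty(2^{-j}n)\right|=0 .$$ Moreover, for every $f\in\ell^\infty(\mathbb{Z})$, the limit function $f^\infty$ belongs to $C^{1-}$ if $p\le 4$, and to $C^{(-\log_2(3/4))-}$ if $p\ge 5$. -/

import Mathlib

open Filter Topology
open scoped ENNReal

noncomputable section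

namespace PowerP

/-- The second order differences `(Df)_n = f_{n+1} - 2 f_n + f_{n-1}`. -/
def secondDiff (f : ℤ → ℝ) (n : ℤ) : ℝ := f (n + 1) - 2 * f n + f (n - 1)

/-- The mean `power_p (x, y)`, with `sign 0 = 0`. When `x + y = 0` the factor `sign x + sign y`
vanishes, so the value is `0` whatever meaning is given to the quotient. -/
def powerMean (p : ℕ) (x y : ℝ) : ℝ :=
  (Real.sign x + Real.sign y) / 2 * ((x + y) / 2) * (1 - |(x - y) / (x + y)| ^ p)

/-- The interpolatory four-point scheme built on a mean `m` of two consecutive second order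
differences; the arithmetic mean gives the centered four-point Lagrange scheme.
Here `k / 2` is the floor, so `k = 2 * (k / 2)` for even `k` and `k = 2 * (k / 2) + 1` for odd. -/
def fourPointScheme (m : ℝ → ℝ → ℝ) (f : ℤ → ℝ) (k : ℤ) : ℝ :=
  if Even k then f (k / 2)
  else (f (k / 2) + f (k / 2 + 1)) / 2
    - 1 / 8 * m (secondDiff f (k / 2)) (secondDiff f (k / 2 + 1))

theorem fourPointScheme_even (m : ℝ → ℝ → ℝ) (f : ℤ → ℝ) (n : ℤ) :
    fourPointScheme m f (2 * n) = f n := by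
  simp [fourPointScheme]

theorem fourPointScheme_odd (m : ℝ → ℝ → ℝ) (f : ℤ → ℝ) (n : ℤ) :
    fourPointScheme m f (2 * n + 1) = (f n + f (n + 1)) / 2
      - 1 / 8 * m (secondDiff f n) (secondDiff f (n + 1)) := by
  have h : ¬ Even (2 * n + 1) := by simp
  have h2 : (2 * n + 1) / 2 = n := by omega
  rw [fourPointScheme, if_neg h, h2]

/-- The Power-P subdivision scheme. -/
def powerScheme (p : ℕ) : (ℤ → ℝ) → (ℤ → ℝ) := fourPointScheme (powerMean p)

/-- `g` is a (continuous) limit function of the scheme `S` started at `f`: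
`sup_n |S^j(f)_n - g(2^{-j} n)| → 0` as `j → ∞` (the supremum is taken in `[0, ∞]`). -/
def IsLimitFunction (S : (ℤ → ℝ) → (ℤ → ℝ)) (f : ℤ → ℝ) (g : ℝ → ℝ) : Prop :=
  Continuous g ∧
    Tendsto (fun j : ℕ => ⨆ n : ℤ, edist (S^[j] f n) (g ((n : ℝ) / 2 ^ j))) atTop (𝓝 0)

/-- Uniform convergence of a subdivision scheme on `ℓ^∞(ℤ)`. -/
def UniformlyConvergent (S : (ℤ → ℝ) → (ℤ → ℝ)) : Prop :=
  ∀ f : ℤ → ℝ, Memℓp f ∞ → ∃ g : ℝ → ℝ, IsLimitFunction S f g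

/-- The class `C^{α-}` for `0 < α ≤ 1`: bounded continuous functions that are globally
Hölder continuous of every positive exponent `a < α`. -/
def HolderMinus (α : ℝ) (g : ℝ → ℝ) : Prop :=
  Continuous g ∧ (∃ B : ℝ, ∀ x, |g x| ≤ B) ∧
    ∀ a : ℝ, 0 < a → a < α → ∃ C : ℝ, 0 < C ∧ ∀ x y : ℝ, |g x - g y| ≤ C * |x - y| ^ a

end PowerP

end

open Filter Topology
open scoped ENNReal

namespace PowerP

/-! The mean takes values in `[0, M]` on arguments bounded by `M`, even when both are negative, and
vanishes across a sign change. Odd second differences are therefore nonnegative after one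
refinement, so a negative one is isolated; both means at it vanish and it is exactly halved. Hence
second differences are `O(2^{-j})`. First differences obey `E_{j+1} ≤ E_j / 2 + M_j / 8`, so they
are `O(r^j)` for every `r > 1/2`.

Since the scheme is interpolatory, the dyadic step functions then converge geometrically, and `r =
2^{-a}` gives Hölder exponent `a` for every `a < 1`. This holds for all `p`; the exponent claimed
for `p ≥ 5` is weaker because `-log₂(3/4) ≤ 1`. -/

theorem powerMean_comm (p : ℕ) (x y : ℝ) : powerMean p x y = powerMean p y x := by
  unfold powerMean
  rw [add_comm x y, add_comm (Real.sign x), abs_div, abs_div, abs_sub_comm]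

/-- The mean is even rather than odd: it is nonnegative also on pairs of negative numbers. -/
theorem powerMean_neg (p : ℕ) (x y : ℝ) : powerMean p (-x) (-y) = powerMean p x y := by
  unfold powerMean
  have h : (-x - -y) / (-x + -y) = (x - y) / (x + y) := by
    rw [← neg_div_neg_eq]
    congr 1 <;> ring
  rw [h, Real.sign_neg, Real.sign_neg]
  ring

theorem powerMean_of_nonneg_of_nonpos (p : ℕ) {x y : ℝ} (hx : 0 ≤ x) (hy : y ≤ 0) :
    powerMean p x y = 0 := by
  unfold powerMean
  rcases hx.eq_or_lt with rfl | hx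
  · rcases hy.eq_or_lt with rfl | hy
    · simp
    · simp [hy.ne]
  · rcases hy.eq_or_lt with rfl | hy
    · simp [hx.ne']
    · simp [Real.sign_of_pos hx, Real.sign_of_neg hy]

theorem powerMean_mem_Icc (p : ℕ) {x y : ℝ} (hx : 0 < x) (hy : 0 < y) :
    powerMean p x y ∈ Set.Icc 0 ((x + y) / 2) := by
  have hs : 0 < x + y := by positivity
  have ht : |(x - y) / (x + y)| ≤ 1 := by
    rw [abs_div, abs_of_pos hs, div_le_one hs, abs_le]
    constructor <;> linarith
  have h0 : 0 ≤ |(x - y) / (x + y)| ^ p := by positivity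
  have h1 : |(x - y) / (x + y)| ^ p ≤ 1 := pow_le_one₀ (abs_nonneg _) ht
  unfold powerMean
  rw [Real.sign_of_pos hx, Real.sign_of_pos hy]
  constructor <;> nlinarith

theorem powerMean_mem_Icc_of_abs_le (p : ℕ) {x y M : ℝ} (hx : |x| ≤ M) (hy : |y| ≤ M) :
    powerMean p x y ∈ Set.Icc 0 M := by
  wlog h : 0 ≤ x generalizing x y
  · rw [← powerMean_neg]
    exact this (by rwa [abs_neg]) (by rwa [abs_neg]) (by linarith)
  have hM : 0 ≤ M := (abs_nonneg x).trans hx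
  rcases le_or_gt y 0 with h' | h'
  · rw [powerMean_of_nonneg_of_nonpos p h h']
    exact ⟨le_rfl, hM⟩
  rcases h.eq_or_lt with rfl | h
  · rw [powerMean_comm, powerMean_of_nonneg_of_nonpos p h'.le le_rfl]
    exact ⟨le_rfl, hM⟩
  · obtain ⟨h1, h2⟩ := powerMean_mem_Icc p h h'
    exact ⟨h1, by linarith [le_abs_self x, le_abs_self y]⟩

theorem powerMean_nonneg (p : ℕ) (x y : ℝ) : 0 ≤ powerMean p x y :=
  (powerMean_mem_Icc_of_abs_le p (le_max_left |x| |y|) (le_max_right _ _)).1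

/-! ### Decay of second and first differences -/

theorem secondDiff_fourPointScheme_odd (m : ℝ → ℝ → ℝ) (f : ℤ → ℝ) (n : ℤ) :
    secondDiff (fourPointScheme m f) (2 * n + 1)
      = 1 / 4 * m (secondDiff f n) (secondDiff f (n + 1)) := by
  rw [secondDiff, fourPointScheme_odd, show 2 * n + 1 + 1 = 2 * (n + 1) by ring,
    show 2 * n + 1 - 1 = 2 * n by ring, fourPointScheme_even, fourPointScheme_even]
  ring

theorem secondDiff_fourPointScheme_even (m : ℝ → ℝ → ℝ) (f : ℤ → ℝ) (n : ℤ) :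
    secondDiff (fourPointScheme m f) (2 * n)
      = secondDiff f n / 2 - 1 / 8 * (m (secondDiff f (n - 1)) (secondDiff f n)
        + m (secondDiff f n) (secondDiff f (n + 1))) := by
  rw [secondDiff, fourPointScheme_odd, show 2 * n - 1 = 2 * (n - 1) + 1 by ring,
    fourPointScheme_odd, fourPointScheme_even, sub_add_cancel, secondDiff.eq_1 f n]
  ring

/-- The worst case is an even index amid equal negative differences: `-M/2 - 2M/8`. Used alone, this
rate would give only the exponent `-log₂(3/4)`. -/
theorem abs_secondDiff_powerScheme_le (p : ℕ) {f : ℤ → ℝ} {M : ℝ}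
    (hf : ∀ n, |secondDiff f n| ≤ M) (k : ℤ) :
    |secondDiff (powerScheme p f) k| ≤ 3 / 4 * M := by
  unfold powerScheme
  rcases Int.even_or_odd' k with ⟨n, rfl | rfl⟩
  · rw [secondDiff_fourPointScheme_even]
    have h := abs_le.1 (hf n)
    have h1 := powerMean_mem_Icc_of_abs_le p (hf (n - 1)) (hf n)
    have h2 := powerMean_mem_Icc_of_abs_le p (hf n) (hf (n + 1))
    rw [abs_le]
    constructor <;> linarith [h1.1, h1.2, h2.1, h2.2]
  · rw [secondDiff_fourPointScheme_odd]
    have h1 := powerMean_mem_Icc_of_abs_le p (hf n) (hf (n + 1))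
    rw [abs_le]
    constructor <;> linarith [h1.1, h1.2]

/-- Sequences whose second order differences have no two consecutive negative terms. -/
def NoConsecutiveNeg (f : ℤ → ℝ) : Prop := ∀ n, 0 ≤ secondDiff f n ∨ 0 ≤ secondDiff f (n + 1)

/-- The odd second order differences of a refined sequence are values of the mean, hence
nonnegative. -/
theorem noConsecutiveNeg_powerScheme (p : ℕ) (f : ℤ → ℝ) :
    NoConsecutiveNeg (powerScheme p f) := by
  have h (n : ℤ) : 0 ≤ secondDiff (powerScheme p f) (2 * n + 1) := by
    rw [powerScheme, secondDiff_fourPointScheme_odd]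
    exact mul_nonneg (by norm_num) (powerMean_nonneg p _ _)
  intro k
  rcases Int.even_or_odd' k with ⟨n, rfl | rfl⟩
  · exact Or.inr (h n)
  · exact Or.inl (h n)

/-- At a nonnegative difference the two means subtract at most `M/4` from a value in `[0, M/2]`; at
a negative one both neighbours are nonnegative, so the means vanish. -/
theorem NoConsecutiveNeg.abs_secondDiff_powerScheme_le (p : ℕ) {f : ℤ → ℝ} {M : ℝ}
    (h : NoConsecutiveNeg f) (hf : ∀ n, |secondDiff f n| ≤ M) (k : ℤ) :
    |secondDiff (powerScheme p f) k| ≤ M / 2 := by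
  unfold powerScheme
  have hM : 0 ≤ M := (abs_nonneg _).trans (hf 0)
  rcases Int.even_or_odd' k with ⟨n, rfl | rfl⟩
  · rw [secondDiff_fourPointScheme_even]
    have h0 := abs_le.1 (hf n)
    rcases le_or_gt 0 (secondDiff f n) with hn | hn
    · have h1 := powerMean_mem_Icc_of_abs_le p (hf (n - 1)) (hf n)
      have h2 := powerMean_mem_Icc_of_abs_le p (hf n) (hf (n + 1))
      rw [abs_le]
      constructor <;> linarith [h1.1, h1.2, h2.1, h2.2]
    · have h1 : 0 ≤ secondDiff f (n + 1) := (h n).resolve_left hn.not_ge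
      have h2 : 0 ≤ secondDiff f (n - 1) := by
        refine (h (n - 1)).resolve_right ?_
        rw [sub_add_cancel]
        exact hn.not_ge
      rw [powerMean_of_nonneg_of_nonpos p h2 hn.le, powerMean_comm p (secondDiff f n),
        powerMean_of_nonneg_of_nonpos p h1 hn.le, abs_le]
      constructor <;> linarith
  · rw [secondDiff_fourPointScheme_odd]
    have h1 := powerMean_mem_Icc_of_abs_le p (hf n) (hf (n + 1))
    rw [abs_le]
    constructor <;> linarith [h1.1, h1.2]

theorem abs_sub_powerScheme_le (p : ℕ) {f : ℤ → ℝ} {M E : ℝ}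
    (hf : ∀ n, |secondDiff f n| ≤ M) (hE : ∀ n, |f (n + 1) - f n| ≤ E) (k : ℤ) :
    |powerScheme p f (k + 1) - powerScheme p f k| ≤ E / 2 + M / 8 := by
  unfold powerScheme
  rcases Int.even_or_odd' k with ⟨n, rfl | rfl⟩
  · rw [fourPointScheme_odd, fourPointScheme_even]
    have h1 := powerMean_mem_Icc_of_abs_le p (hf n) (hf (n + 1))
    have h2 := abs_le.1 (hE n)
    rw [abs_le]
    constructor <;> linarith [h1.1, h1.2]
  · rw [show 2 * n + 1 + 1 = 2 * (n + 1) by ring, fourPointScheme_odd, fourPointScheme_even]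
    have h1 := powerMean_mem_Icc_of_abs_le p (hf n) (hf (n + 1))
    have h2 := abs_le.1 (hE n)
    rw [abs_le]
    constructor <;> linarith [h1.1, h1.2]

/-- The second order differences are halved in every step but the first. -/
theorem abs_secondDiff_iterate_le (p : ℕ) {f : ℤ → ℝ} {M : ℝ}
    (hf : ∀ n, |secondDiff f n| ≤ M) (j : ℕ) (n : ℤ) :
    |secondDiff ((powerScheme p)^[j] f) n| ≤ 2 * M * (1 / 2) ^ j := by
  have hM : 0 ≤ M := (abs_nonneg _).trans (hf 0)
  cases j with
  -- The factor 2 absorbs the first step, where only `3/4` is available.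
  | zero => simpa using (hf n).trans (by linarith)
  | succ j =>
    induction j generalizing n with
    | zero =>
      refine (abs_secondDiff_powerScheme_le p hf n).trans ?_
      norm_num
      linarith
    | succ j ih =>
      rw [Function.iterate_succ_apply']
      have h : NoConsecutiveNeg ((powerScheme p)^[j + 1] f) := by
        rw [Function.iterate_succ_apply']
        exact noConsecutiveNeg_powerScheme p _
      refine (h.abs_secondDiff_powerScheme_le p ih n).trans_eq ?_
      rw [pow_succ _ (j + 1)]
      ring

/-- The first order differences decay like `r ^ j` for every `r > 1 / 2`. -/
theorem exists_abs_sub_iterate_le (p : ℕ) {f : ℤ → ℝ} {B : ℝ} (hf : ∀ n, |f n| ≤ B)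
    {r : ℝ} (hr : 1 / 2 < r) :
    ∃ K, 0 ≤ K ∧ ∀ (j : ℕ) (n : ℤ),
      |(powerScheme p)^[j] f (n + 1) - (powerScheme p)^[j] f n| ≤ K * r ^ j := by
  have hB : 0 ≤ B := (abs_nonneg _).trans (hf 0)
  have hr' : 0 < r - 1 / 2 := by linarith
  have hM : ∀ n, |secondDiff f n| ≤ 4 * B := fun n => by
    have h1 := abs_le.1 (hf n)
    have h2 := abs_le.1 (hf (n + 1))
    have h3 := abs_le.1 (hf (n - 1))
    rw [secondDiff, abs_le]
    constructor <;> linarith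
  -- `2 * B` covers `j = 0`. With `M = 4 * B` the recursion adds `B * (1/2)^j`, so the induction
  -- closes once `B ≤ K * (r - 1/2)`.
  refine ⟨2 * B + B / (r - 1 / 2), by positivity, fun j => ?_⟩
  set K := 2 * B + B / (r - 1 / 2) with hK
  have hKr : B ≤ K * (r - 1 / 2) := by
    rw [hK, add_mul, div_mul_cancel₀ _ hr'.ne']
    nlinarith
  induction j with
  | zero =>
    intro n
    have h1 := abs_le.1 (hf n)
    have h2 := abs_le.1 (hf (n + 1))
    have h3 : 0 ≤ B / (r - 1 / 2) := by positivity
    simp only [Function.iterate_zero_apply, pow_zero, abs_le]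
    constructor <;> linarith
  | succ j ih =>
    intro n
    rw [Function.iterate_succ_apply']
    refine (abs_sub_powerScheme_le p (abs_secondDiff_iterate_le p hM j) ih n).trans ?_
    have h1 : (1 / 2 : ℝ) ^ j ≤ r ^ j := by gcongr
    have h2 : 0 ≤ r ^ j := pow_nonneg (by linarith) j
    rw [pow_succ]
    nlinarith [mul_le_mul_of_nonneg_right hKr h2, mul_le_mul_of_nonneg_left h1 hB]

/-! ### Limits of dyadic step functions -/

/-- The step function with value `F j n` on `[n / 2 ^ j, (n + 1) / 2 ^ j)`. -/
noncomputable def dyadicStep (F : ℕ → ℤ → ℝ) (j : ℕ) (x : ℝ) : ℝ := F j ⌊2 ^ j * x⌋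

section DyadicStep

variable {F : ℕ → ℤ → ℝ} {K r : ℝ}

/-- The finer floor is `2n` or `2n + 1`, so the value is kept or moves by one first difference. -/
theorem dist_dyadicStep_succ_le (hF : ∀ j n, F (j + 1) (2 * n) = F j n) (hK : 0 ≤ K)
    (hr0 : 0 ≤ r) (hr1 : r ≤ 1) (hd : ∀ j n, |F j (n + 1) - F j n| ≤ K * r ^ j) (j : ℕ) (x : ℝ) :
    dist (dyadicStep F j x) (dyadicStep F (j + 1) x) ≤ K * r ^ j := by
  unfold dyadicStep
  set n := ⌊2 ^ j * x⌋ with hn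
  have h1 : (n : ℝ) ≤ 2 ^ j * x := Int.floor_le _
  have h2 : 2 ^ j * x < n + 1 := Int.lt_floor_add_one _
  have h3 : (2 : ℝ) ^ (j + 1) * x = 2 * (2 ^ j * x) := by ring
  have h4 : 2 * n ≤ ⌊(2 : ℝ) ^ (j + 1) * x⌋ := by
    rw [Int.le_floor, h3]
    push_cast
    linarith
  have h5 : ⌊(2 : ℝ) ^ (j + 1) * x⌋ < 2 * n + 2 := by
    rw [Int.floor_lt, h3]
    push_cast
    linarith
  have h6 : ⌊(2 : ℝ) ^ (j + 1) * x⌋ = 2 * n ∨ ⌊(2 : ℝ) ^ (j + 1) * x⌋ = 2 * n + 1 := by omega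
  rcases h6 with h | h
  · rw [h, hF, dist_self]
    positivity
  · rw [h, ← hF j n, dist_comm, Real.dist_eq]
    refine (hd _ _).trans ?_
    gcongr ?_ * ?_
    exact pow_le_pow_of_le_one hr0 hr1 j.le_succ

theorem abs_dyadicStep_sub_le (hK : 0 ≤ K) (hr0 : 0 ≤ r)
    (hd : ∀ j n, |F j (n + 1) - F j n| ≤ K * r ^ j) {j : ℕ} {x y : ℝ}
    (hxy : |x - y| ≤ (1 / 2) ^ j) :
    |dyadicStep F j x - dyadicStep F j y| ≤ K * r ^ j := by
  wlog h : y ≤ x generalizing x y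
  · rw [abs_sub_comm]
    exact this (by rwa [abs_sub_comm]) (le_of_not_ge h)
  unfold dyadicStep
  have h2 : (0 : ℝ) < 2 ^ j := by positivity
  have h3 : (2 : ℝ) ^ j * x ≤ 2 ^ j * y + 1 := by
    have := mul_le_mul_of_nonneg_left ((le_abs_self _).trans hxy) h2.le
    rw [← mul_pow] at this
    norm_num at this
    linarith
  have h4 : ⌊(2 : ℝ) ^ j * y⌋ ≤ ⌊(2 : ℝ) ^ j * x⌋ := Int.floor_mono (by gcongr)
  have h5 : ⌊(2 : ℝ) ^ j * x⌋ ≤ ⌊(2 : ℝ) ^ j * y⌋ + 1 := by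
    rw [← Int.floor_add_one]
    exact Int.floor_mono h3
  have h6 : ⌊(2 : ℝ) ^ j * x⌋ = ⌊(2 : ℝ) ^ j * y⌋ ∨
    ⌊(2 : ℝ) ^ j * x⌋ = ⌊(2 : ℝ) ^ j * y⌋ + 1 := by omega
  rcases h6 with h | h
  · rw [h, sub_self, abs_zero]
    positivity
  · rw [h]
    exact hd _ _

theorem abs_dyadicStep_sub_limit_le (hF : ∀ j n, F (j + 1) (2 * n) = F j n) (hK : 0 ≤ K)
    (hr0 : 0 ≤ r) (hr1 : r < 1) (hd : ∀ j n, |F j (n + 1) - F j n| ≤ K * r ^ j) {g : ℝ → ℝ}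
    (hg : ∀ x, Tendsto (fun j => dyadicStep F j x) atTop (𝓝 (g x))) (j : ℕ) (x : ℝ) :
    |dyadicStep F j x - g x| ≤ K / (1 - r) * r ^ j := by
  have := dist_le_of_le_geometric_of_tendsto r K hr1
    (fun j => dist_dyadicStep_succ_le hF hK hr0 hr1.le hd j x) (hg x) j
  rw [Real.dist_eq] at this
  refine this.trans_eq ?_
  ring

theorem abs_limit_le (hF : ∀ j n, F (j + 1) (2 * n) = F j n) (hK : 0 ≤ K)
    (hr0 : 0 ≤ r) (hr1 : r < 1) (hd : ∀ j n, |F j (n + 1) - F j n| ≤ K * r ^ j) {g : ℝ → ℝ}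
    (hg : ∀ x, Tendsto (fun j => dyadicStep F j x) atTop (𝓝 (g x))) {B : ℝ}
    (hB : ∀ n, |F 0 n| ≤ B) (x : ℝ) : |g x| ≤ B + K / (1 - r) := by
  have h1 := abs_le.1 (abs_dyadicStep_sub_limit_le hF hK hr0 hr1 hd hg 0 x)
  have h2 : -B ≤ dyadicStep F 0 x ∧ dyadicStep F 0 x ≤ B := abs_le.1 (hB _)
  rw [pow_zero, mul_one] at h1
  rw [abs_le]
  constructor <;> linarith

theorem exists_holder_limit (hF : ∀ j n, F (j + 1) (2 * n) = F j n) {a : ℝ} (ha : 0 < a)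
    (hK : 0 ≤ K) (hd : ∀ j n, |F j (n + 1) - F j n| ≤ K * ((1 / 2 : ℝ) ^ a) ^ j) {g : ℝ → ℝ}
    (hg : ∀ x, Tendsto (fun j => dyadicStep F j x) atTop (𝓝 (g x))) {B : ℝ}
    (hB : ∀ n, |F 0 n| ≤ B) :
    ∃ C : ℝ, 0 < C ∧ ∀ x y : ℝ, |g x - g y| ≤ C * |x - y| ^ a := by
  set r : ℝ := (1 / 2 : ℝ) ^ a with hr
  have hr0 : 0 < r := by positivity
  have hr1 : r < 1 := Real.rpow_lt_one (by norm_num) (by norm_num) ha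
  have hr1' : 0 < 1 - r := by linarith
  have hB0 : 0 ≤ B := (abs_nonneg _).trans (hB 0)
  set L := K / (1 - r) with hL
  have hL0 : 0 ≤ L := by positivity
  -- The first term serves `|x - y| ≤ 1`, the second (from boundedness) larger distances; the 1
  -- ensures positivity.
  refine ⟨(2 * L + K) / r + 2 * (B + L) + 1, by positivity, fun x y => ?_⟩
  have hA : 0 ≤ |x - y| ^ a := by positivity
  have hC1 : 0 ≤ (2 * L + K) / r := by positivity
  rcases le_or_gt |x - y| 1 with h1 | h1
  · rcases (abs_nonneg (x - y)).eq_or_lt with h0 | h0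
    · rw [sub_eq_zero.1 (abs_eq_zero.1 h0.symm), sub_self, abs_zero]
      positivity
    -- Choose the dyadic scale `2^{-(j+1)} < |x - y| ≤ 2^{-j}`, where `r^j` is comparable to `|x -
    -- y|^a`.
    · obtain ⟨j, hj1, hj2⟩ := exists_nat_pow_near_of_lt_one h0 h1
        (by norm_num : (0 : ℝ) < 1 / 2) (by norm_num)
      have h2 := abs_le.1 (abs_dyadicStep_sub_limit_le hF hK hr0.le hr1 hd hg j x)
      have h3 := abs_le.1 (abs_dyadicStep_sub_limit_le hF hK hr0.le hr1 hd hg j y)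
      have h4 := abs_le.1 (abs_dyadicStep_sub_le hK hr0.le hd hj2)
      have h5 : r ^ j * r ≤ |x - y| ^ a := by
        rw [← pow_succ, hr, ← Real.rpow_natCast, ← Real.rpow_mul (by norm_num), mul_comm a,
          Real.rpow_mul (by norm_num), Real.rpow_natCast]
        gcongr
      have h6 : |g x - g y| ≤ (2 * L + K) * r ^ j := by
        rw [abs_le]
        constructor <;> linarith
      have h7 : (2 * L + K) * r ^ j ≤ (2 * L + K) / r * |x - y| ^ a := by
        calc (2 * L + K) * r ^ j = (2 * L + K) / r * (r ^ j * r) := by field_simp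
          _ ≤ _ := by gcongr
      have h8 : 0 ≤ (2 * (B + L) + 1) * |x - y| ^ a := by positivity
      linarith
  · have h2 := abs_le.1 (abs_limit_le hF hK hr0.le hr1 hd hg hB x)
    have h3 := abs_le.1 (abs_limit_le hF hK hr0.le hr1 hd hg hB y)
    have h4 : 1 ≤ |x - y| ^ a := Real.one_le_rpow h1.le ha.le
    have h5 : |g x - g y| ≤ 2 * (B + L) * 1 := by
      rw [abs_le]
      constructor <;> linarith
    have h6 : 2 * (B + L) * 1 ≤ 2 * (B + L) * |x - y| ^ a := by gcongr
    have h7 : 0 ≤ ((2 * L + K) / r + 1) * |x - y| ^ a := by positivity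
    linarith

end DyadicStep

theorem continuous_of_holder {g : ℝ → ℝ} {C a : ℝ} (ha : 0 < a)
    (hg : ∀ x y, |g x - g y| ≤ C * |x - y| ^ a) : Continuous g := by
  rw [continuous_iff_continuousAt]
  intro y
  rw [ContinuousAt, tendsto_iff_dist_tendsto_zero]
  have hc : Continuous fun x : ℝ => C * |x - y| ^ a :=
    continuous_const.mul ((continuous_id.sub continuous_const).abs.rpow_const
      fun _ => Or.inr ha.le)
  have h0 : Tendsto (fun x : ℝ => C * |x - y| ^ a) (𝓝 y) (𝓝 0) := by
    simpa [Real.zero_rpow ha.ne'] using hc.tendsto y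
  exact squeeze_zero (fun _ => dist_nonneg) (fun x => hg x y) h0

/-! ### Limit functions of the scheme -/

theorem dyadicStep_div_two_pow (F : ℕ → ℤ → ℝ) (j : ℕ) (n : ℤ) :
    dyadicStep F j ((n : ℝ) / 2 ^ j) = F j n := by
  rw [dyadicStep, mul_div_cancel₀ _ (by positivity), Int.floor_intCast]

theorem tendsto_floor_two_pow_mul_div (x : ℝ) :
    Tendsto (fun j : ℕ => (⌊2 ^ j * x⌋ : ℝ) / 2 ^ j) atTop (𝓝 x) := by
  have h0 : Tendsto (fun j : ℕ => (1 / 2 : ℝ) ^ j) atTop (𝓝 0) :=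
    tendsto_pow_atTop_nhds_zero_of_lt_one (by norm_num) (by norm_num)
  refine tendsto_of_tendsto_of_tendsto_of_le_of_le
    (by simpa using tendsto_const_nhds.sub h0 : Tendsto (fun j : ℕ => x - (1 / 2 : ℝ) ^ j) _ (𝓝 x))
    tendsto_const_nhds (fun j => ?_) fun j => ?_
  · have h1 := Int.lt_floor_add_one ((2 : ℝ) ^ j * x)
    rw [le_div_iff₀ (by positivity), sub_mul, ← mul_pow]
    norm_num
    linarith
  · rw [div_le_iff₀ (by positivity), mul_comm x]
    exact Int.floor_le _

/-- A limit function is the pointwise limit of the associated step functions. -/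
theorem IsLimitFunction.tendsto_dyadicStep {S : (ℤ → ℝ) → (ℤ → ℝ)} {f : ℤ → ℝ} {g : ℝ → ℝ}
    (h : IsLimitFunction S f g) (x : ℝ) :
    Tendsto (fun j => dyadicStep (fun j => S^[j] f) j x) atTop (𝓝 (g x)) := by
  -- The supremum controls grid points only; continuity of `g` carries this to `x`.
  have h1 : Tendsto (fun j : ℕ => g ((⌊2 ^ j * x⌋ : ℝ) / 2 ^ j)) atTop (𝓝 (g x)) :=
    (h.1.tendsto x).comp (tendsto_floor_two_pow_mul_div x)
  rw [tendsto_iff_edist_tendsto_0] at h1 ⊢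
  have h2 := h.2.add h1
  rw [add_zero] at h2
  refine tendsto_of_tendsto_of_tendsto_of_le_of_le tendsto_const_nhds h2 (fun _ => zero_le)
    fun j => (edist_triangle _ (g ((⌊2 ^ j * x⌋ : ℝ) / 2 ^ j)) _).trans ?_
  gcongr
  exact le_iSup (fun n : ℤ => edist (S^[j] f n) (g ((n : ℝ) / 2 ^ j))) ⌊2 ^ j * x⌋

theorem powerScheme_iterate_succ_two_mul (p : ℕ) (f : ℤ → ℝ) (j : ℕ) (n : ℤ) :
    (powerScheme p)^[j + 1] f (2 * n) = (powerScheme p)^[j] f n := by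
  rw [Function.iterate_succ_apply', powerScheme, fourPointScheme_even]

theorem exists_abs_le_of_memlp {f : ℤ → ℝ} (hf : Memℓp f ∞) : ∃ B, ∀ n, |f n| ≤ B := by
  obtain ⟨B, hB⟩ := memℓp_infty_iff.1 hf
  exact ⟨B, fun n => hB ⟨n, rfl⟩⟩

theorem exists_abs_sub_iterate_le_rpow (p : ℕ) {f : ℤ → ℝ} {B : ℝ} (hf : ∀ n, |f n| ≤ B)
    {a : ℝ} (ha : a < 1) :
    ∃ K, 0 ≤ K ∧ ∀ (j : ℕ) (n : ℤ),
      |(powerScheme p)^[j] f (n + 1) - (powerScheme p)^[j] f n|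
        ≤ K * ((1 / 2 : ℝ) ^ a) ^ j := by
  refine exists_abs_sub_iterate_le p hf ?_
  simpa using Real.rpow_lt_rpow_of_exponent_gt (by norm_num : (0 : ℝ) < 1 / 2) (by norm_num) ha

theorem uniformlyConvergent_powerScheme (p : ℕ) : UniformlyConvergent (powerScheme p) := by
  intro f hf
  obtain ⟨B, hB⟩ := exists_abs_le_of_memlp hf
  obtain ⟨K, hK, hd⟩ := exists_abs_sub_iterate_le_rpow p hB (by norm_num : (1 / 2 : ℝ) < 1)
  have hF := powerScheme_iterate_succ_two_mul p f
  have hr0 : (0 : ℝ) ≤ (1 / 2 : ℝ) ^ (1 / 2 : ℝ) := by positivity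
  have hr1 : (1 / 2 : ℝ) ^ (1 / 2 : ℝ) < 1 :=
    Real.rpow_lt_one (by norm_num) (by norm_num) (by norm_num)
  choose g hg using fun x => cauchySeq_tendsto_of_complete (cauchySeq_of_le_geometric _ K hr1
    fun j => dist_dyadicStep_succ_le (F := fun j => (powerScheme p)^[j] f) hF hK hr0 hr1.le hd j x)
  obtain ⟨C, -, hC⟩ := exists_holder_limit (F := fun j => (powerScheme p)^[j] f) hF
    (by norm_num) hK hd hg hB
  refine ⟨g, continuous_of_holder (by norm_num) hC, ?_⟩
  set r : ℝ := (1 / 2 : ℝ) ^ (1 / 2 : ℝ)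
  have hlim : Tendsto (fun j : ℕ => ENNReal.ofReal (K / (1 - r) * r ^ j)) atTop (𝓝 0) := by
    have := (tendsto_pow_atTop_nhds_zero_of_lt_one hr0 hr1).const_mul (K / (1 - r))
    simpa using ENNReal.tendsto_ofReal this
  refine tendsto_of_tendsto_of_tendsto_of_le_of_le tendsto_const_nhds hlim
    (fun _ => zero_le) fun j => iSup_le fun n => ?_
  rw [edist_dist, Real.dist_eq]
  refine ENNReal.ofReal_le_ofReal ?_
  have := abs_dyadicStep_sub_limit_le (F := fun j => (powerScheme p)^[j] f) hF hK hr0 hr1 hd hg j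
    ((n : ℝ) / 2 ^ j)
  rwa [dyadicStep_div_two_pow] at this

/-- For every `p` the limit functions of the Power-P scheme are in `C^{1-}`. -/
theorem IsLimitFunction.holderMinus_one {p : ℕ} {f : ℤ → ℝ} {g : ℝ → ℝ} (hf : Memℓp f ∞)
    (hg : IsLimitFunction (powerScheme p) f g) : HolderMinus 1 g := by
  obtain ⟨B, hB⟩ := exists_abs_le_of_memlp hf
  have hF := powerScheme_iterate_succ_two_mul p f
  refine ⟨hg.1, ?_, fun a ha0 ha1 => ?_⟩
  · obtain ⟨K, hK, hd⟩ := exists_abs_sub_iterate_le_rpow p hB (by norm_num : (1 / 2 : ℝ) < 1)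
    exact ⟨_, abs_limit_le (F := fun j => (powerScheme p)^[j] f) hF hK (by positivity)
      (Real.rpow_lt_one (by norm_num) (by norm_num) (by norm_num)) hd hg.tendsto_dyadicStep hB⟩
  · obtain ⟨K, hK, hd⟩ := exists_abs_sub_iterate_le_rpow p hB ha1
    exact exists_holder_limit (F := fun j => (powerScheme p)^[j] f) hF ha0 hK hd
      hg.tendsto_dyadicStep hB

theorem HolderMinus.mono {α β : ℝ} {g : ℝ → ℝ} (hg : HolderMinus α g) (h : β ≤ α) :
    HolderMinus β g :=
  ⟨hg.1, hg.2.1, fun a ha0 ha => hg.2.2 a ha0 (ha.trans_le h)⟩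

end PowerP

theorem mainTheorem4 (p : ℕ) (hp : 1 ≤ p) :
    PowerP.UniformlyConvergent (PowerP.powerScheme p) ∧
      ∀ (f : ℤ → ℝ) (g : ℝ → ℝ), Memℓp f ∞ →
        PowerP.IsLimitFunction (PowerP.powerScheme p) f g →
          (p ≤ 4 → PowerP.HolderMinus 1 g) ∧
          (5 ≤ p → PowerP.HolderMinus (-Real.logb 2 (3 / 4)) g) := by
  refine ⟨PowerP.uniformlyConvergent_powerScheme p, fun f g hf hg =>
    ⟨fun _ => hg.holderMinus_one hf, fun _ => (hg.holderMinus_one hf).mono ?_⟩⟩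
  -- Reduces `-log₂(3/4) ≤ 1` to `1/2 ≤ 3/4`.
  rw [neg_le, Real.le_logb_iff_rpow_le (by norm_num) (by norm_num), Real.rpow_neg_one]
  norm_num
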